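/- Let $\beta\mathbb{Z}$ be the set of ultrafilters on $\mathbb{Z}$, with the addition $A\in\mathcal{U}+\mathcal{V}\iff\{x:\{y: x+y\in A\}\in\mathcal{V}\}\in\mathcal{U}$; call $\mathcal{U}$ additively idempotent if $\mathcal{U}+\mathcal{U}=\mathcal{U}$. For $a\in\mathbb{Z}$ let $a\mathcal{U}$ be the image of $\mathcal{U}$ under $x\mapsto ax$, and for a finite string of integers $\sigma=(a_1,\dots,a_n)$ let $\sigma\mathcal{U}=a_1\mathcal{U}+\dots+a_n\mathcal{U}$ (for the empty string, the principal ultrafilter at $0$). An ultrafilter $\mathcal{U}\in\beta\mathbb{Z}$ is strongly summable if for every $A\in\mathcal{U}$ there is an injective sequence $(x_n)_{n\in\mathbb{N}}$ of integers such that the set $\operatorname{FS}((x_n))=\{\sum_{n\in F}x_n : F\subseteq\mathbb{N}\text{ finite, non-empty}\}$ is contained in $A$ and belongs to $\mathcal{U}$. For $P\in\mathbb{Z}[x_1,\dots,x_m]$, $\mathcal{U}$ witnesses the partition regularity of $P=0$, written $\mathcal{U}\models P(x_1,\dots,x_m)=0$, if every $A\in\mathcal{U}$ contains $a_1,\dots,a_m$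 with $P(a_1,\dots,a_m)=0$. Let $\approx$ be the smallest equivalence relation on the set of finite strings of integers such that $()\approx(0)$, $(a)\approx(a,a)$ for every $a\in\mathbb{Z}$, and $\sigma\tau\approx\sigma'\tau'$ whenever $\sigma\approx\sigma'$ and $\tau\approx\tau'$ (juxtaposition is concatenation); let $\mathfrak{G}(\sigma)$ be the $\approx$-class of $\sigma$. A string $(a_1,\dots,a_n)$ is reduced if all $a_i\neq 0$ and $a_i\neq a_{i+1}$ for $1\le i<n$. Theorem. Assume that there exists a strongly summable ultrafilter on $\mathbb{Z}$. Let $P=\sum_{j=1}^m c_jx_j\in\mathbb{Z}[x_1,\dots,x_m]$ be a linear homogeneous polynomial and let $\sigma$ be a reduced string of integers. The following are equivalent: (1) $\sigma\mathcal{U}\models P(x_1,\dots,x_m)=0$ for every additively idempotent $\mathcal{U}\in\beta\mathbb{Z}$; (2) $\sigma\mathcal{U}\models P(x_1,\dots,x_m)=0$ for some strongly summable $\mathcal{U}\in\beta\mathbb{Z}$; (3) $P=0$ has a solution in $\mathfrak{G}(\sigma)$: there are strings $\sigma_1,\dots,\sigma_m\in\mathfrak{G}(\sigma)$, all of the same length,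 such that $\sum_{j=1}^m c_j\sigma_j=0$ componentwise. -/

import Mathlib

namespace StringPR

section Ultrafilters

attribute [local instance] Ultrafilter.add

/-- `U` is idempotent for the addition of `βℤ`, where
`A ∈ U + V ↔ {x | {y | x + y ∈ A} ∈ V} ∈ U`. -/
def IsAddIdempotent (U : Ultrafilter ℤ) : Prop :=
  U + U = U

/-- The linear combination `σU = a₁U + ⋯ + aₙU` of a string `σ = (a₁, …, aₙ)`, where `aU` is
the image of `U` under `x ↦ a * x`. The empty combination is the neutral element of `βℤ`, the
principal ultrafilter at `0`. -/
def linComb : List ℤ → Ultrafilter ℤ → Ultrafilter ℤ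
  | [], _ => pure 0
  | a :: σ, U => U.map (fun x => a * x) + linComb σ U

end Ultrafilters

/-- Every member `A` of `U` contains the set of finite sums (over nonempty finite sets of
indices) of some injective sequence, in such a way that this set of finite sums is itself a
member of `U`. -/
def IsStronglySummable (U : Ultrafilter ℤ) : Prop :=
  ∀ A ∈ U, ∃ x : Stream' ℤ, Function.Injective x.get ∧ Hindman.FS x ⊆ A ∧ Hindman.FS x ∈ U

/-- `U ⊨ P(x₁, …, xₘ) = 0`: the ultrafilter `U` witnesses the partition regularity of the
equation `P(x₁, …, xₘ) = 0`. -/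
def Witnesses {m : ℕ} (U : Ultrafilter ℤ) (P : MvPolynomial (Fin m) ℤ) : Prop :=
  ∀ A ∈ U, ∃ a : Fin m → ℤ, (∀ j, a j ∈ A) ∧ MvPolynomial.eval a P = 0

/-- The smallest equivalence relation on strings of integers that identifies `()` with `(0)` and
`(a)` with `(a, a)`, and that is compatible with concatenation. -/
inductive Coherent : List ℤ → List ℤ → Prop
  | nil_zero : Coherent [] [0]
  | dup (a : ℤ) : Coherent [a] [a, a]
  | append {σ σ' τ τ' : List ℤ} :
      Coherent σ σ' → Coherent τ τ' → Coherent (σ ++ τ) (σ' ++ τ')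
  | refl (σ : List ℤ) : Coherent σ σ
  | symm {σ τ : List ℤ} : Coherent σ τ → Coherent τ σ
  | trans {σ τ ρ : List ℤ} : Coherent σ τ → Coherent τ ρ → Coherent σ ρ

/-- The class `𝔊(σ)` of the strings coherent with `σ`. -/
def coherenceClass (σ : List ℤ) : Set (List ℤ) :=
  {τ | Coherent τ σ}

/-- Consecutive entries are distinct and no entry is zero. -/
def IsReduced (σ : List ℤ) : Prop :=
  σ.IsChain (· ≠ ·) ∧ ∀ a ∈ σ, a ≠ 0

/-- The linear homogeneous equation `c₁x₁ + ⋯ + cₘxₘ = 0`, where `cⱼ` is the coefficient of `xⱼ`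
in `P`, is solved by strings `τ₁, …, τₘ ∈ 𝔊(σ)` of the same length `k`, with the operations on
strings taken componentwise. -/
def HasSolutionInClass {m : ℕ} (P : MvPolynomial (Fin m) ℤ) (σ : List ℤ) : Prop :=
  ∃ (k : ℕ) (τ : Fin m → Fin k → ℤ),
    (∀ j, List.ofFn (τ j) ∈ coherenceClass σ) ∧
      ∑ j, P.coeff (Finsupp.single j 1) • τ j = 0

end StringPR

namespace StringPR

section

attribute [local instance] Ultrafilter.add Ultrafilter.addSemigroup

/-! ### Linear combinations of idempotent ultrafilters -/

/-! For idempotent `U`, `linComb σ U` depends only on the coherence class of `σ`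
(`Coherent.linComb_eq`). Strings solving the equation thus all represent the same ultrafilter, and
one tuple of integers evaluates all of them inside a given member (`exists_forall_sum_mem`).
Strongly summable ultrafilters are idempotent, so the universal statement gives the existential one.
Conversely, a strongly summable `U` contains all tails of the finite sums of a sequence `x` with no
nontrivial relation with coefficients below a large prime `p` (`exists_dissociated`). Hence `linComb
σ U` lives on values at `x` of strings coherent with `σ` (`coherentSums_mem_linComb`), and a
solution among these values must vanish coefficient by coefficient. -/

theorem pure_zero_add (V : Ultrafilter ℤ) : (pure 0 : Ultrafilter ℤ) + V = V := by
  refine Ultrafilter.coe_inj.mp (Filter.ext' fun p => ?_)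
  simp [Ultrafilter.eventually_add]

theorem add_pure_zero (V : Ultrafilter ℤ) : V + (pure 0 : Ultrafilter ℤ) = V := by
  refine Ultrafilter.coe_inj.mp (Filter.ext' fun p => ?_)
  simp [Ultrafilter.eventually_add]

theorem map_mul_add (a : ℤ) (U V : Ultrafilter ℤ) :
    (U + V).map (fun x => a * x) = U.map (fun x => a * x) + V.map (fun x => a * x) := by
  refine Ultrafilter.coe_inj.mp (Filter.ext' fun p => ?_)
  simp [Ultrafilter.eventually_add, mul_add]

theorem map_zero_mul (U : Ultrafilter ℤ) : U.map (fun x => 0 * x) = pure 0 := by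
  refine Ultrafilter.coe_inj.mp (Filter.ext' fun p => ?_)
  simp

theorem linComb_append (σ τ : List ℤ) (U : Ultrafilter ℤ) :
    linComb (σ ++ τ) U = linComb σ U + linComb τ U := by
  induction σ with
  | nil => simp [linComb, pure_zero_add]
  | cons a σ ih =>
    rw [List.cons_append, linComb, linComb, ih]
    exact (add_assoc _ _ _).symm

/-- Idempotence enters only through `(a) ≈ (a, a)`, as `aU + aU = a(U + U)`. -/
theorem Coherent.linComb_eq {U : Ultrafilter ℤ} (hU : IsAddIdempotent U) {σ τ : List ℤ}
    (h : Coherent σ τ) : linComb σ U = linComb τ U := by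
  induction h with
  | nil_zero => simp only [linComb, map_zero_mul, add_pure_zero]
  | dup a =>
    simp only [linComb, add_pure_zero]
    rw [← map_mul_add, hU]
  | append _ _ h₁ h₂ => rw [linComb_append, linComb_append, h₁, h₂]
  | refl => rfl
  | symm _ h => exact h.symm
  | trans _ _ h₁ h₂ => exact h₁.trans h₂

theorem mem_linComb_cons {a : ℤ} {σ : List ℤ} {U : Ultrafilter ℤ} {A : Set ℤ} :
    A ∈ linComb (a :: σ) U ↔ {x | {y | a * x + y ∈ A} ∈ linComb σ U} ∈ U :=
  Iff.rfl

/-- Finitely many combinations of `U` by strings of the same length can be realized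
simultaneously by one tuple of integers. -/
theorem exists_forall_sum_mem {ι : Type*} [Finite ι] (U : Ultrafilter ℤ) {k : ℕ}
    (τ : ι → Fin k → ℤ) (A : ι → Set ℤ) (hA : ∀ j, A j ∈ linComb (List.ofFn (τ j)) U) :
    ∃ y : Fin k → ℤ, ∀ j, ∑ i, τ j i * y i ∈ A j := by
  induction k generalizing A with
  | zero =>
    refine ⟨0, fun j => ?_⟩
    have := hA j
    rw [List.ofFn_zero] at this
    simpa [linComb] using this
  | succ k ih =>
    -- There are finitely many `j`, so one `x` serves as first coordinate for all of them.
    have hev : ∀ᶠ x in (U : Filter ℤ), ∀ j,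
        {y | τ j 0 * x + y ∈ A j} ∈ linComb (List.ofFn fun i : Fin k => τ j i.succ) U := by
      rw [Filter.eventually_all]
      intro j
      have := hA j
      rw [List.ofFn_succ, mem_linComb_cons] at this
      exact this
    obtain ⟨x, hx⟩ := hev.exists
    obtain ⟨y, hy⟩ := ih (fun j i => τ j i.succ) _ hx
    refine ⟨Fin.cons x y, fun j => ?_⟩
    simpa [Fin.sum_univ_succ] using hy j

theorem eval_eq_sum_of_isHomogeneous_one {m : ℕ} {P : MvPolynomial (Fin m) ℤ}
    (hP : P.IsHomogeneous 1) (a : Fin m → ℤ) :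
    MvPolynomial.eval a P = ∑ j, P.coeff (Finsupp.single j 1) * a j := by
  have hmem : P ∈ MvPolynomial.homogeneousSubmodule (Fin m) ℤ 1 := hP
  rw [MvPolynomial.homogeneousSubmodule_one_eq_span_X] at hmem
  induction hmem using Submodule.span_induction with
  | mem x hx =>
    obtain ⟨i, rfl⟩ := hx
    simp [MvPolynomial.coeff_X, Finsupp.single_left_inj]
  | zero => simp
  | add x y hx hy h₁ h₂ =>
    rw [← MvPolynomial.homogeneousSubmodule_one_eq_span_X] at hx hy
    simp [h₁ hx, h₂ hy, add_mul, Finset.sum_add_distrib]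
  | smul c x hx h =>
    rw [← MvPolynomial.homogeneousSubmodule_one_eq_span_X] at hx
    simp_rw [MvPolynomial.smul_eval, MvPolynomial.coeff_smul, smul_eq_mul, h hx, Finset.mul_sum,
      mul_assoc]

theorem HasSolutionInClass.witnesses {m : ℕ} {P : MvPolynomial (Fin m) ℤ}
    (hP : P.IsHomogeneous 1) {σ : List ℤ} (h : HasSolutionInClass P σ) {U : Ultrafilter ℤ}
    (hU : IsAddIdempotent U) : Witnesses (linComb σ U) P := by
  intro A hA
  obtain ⟨k, τ, hτ, hsum⟩ := h
  obtain ⟨y, hy⟩ := exists_forall_sum_mem U τ (fun _ => A)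
    fun j => by rw [Coherent.linComb_eq hU (hτ j)]; exact hA
  refine ⟨fun j => ∑ i, τ j i * y i, hy, ?_⟩
  rw [eval_eq_sum_of_isHomogeneous_one hP]
  simp_rw [Finset.mul_sum]
  rw [Finset.sum_comm]
  refine Finset.sum_eq_zero fun i _ => ?_
  have := congrFun hsum i
  simp only [Finset.sum_apply, Pi.smul_apply, smul_eq_mul, Pi.zero_apply] at this
  simp_rw [← mul_assoc, ← Finset.sum_mul, this, zero_mul]

/-! ### Finite sums of dissociated sequences -/

/-- The sums of `x` over nonempty finite sets of indices that are at least `N`. -/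
def tailSums (x : ℕ → ℤ) (N : ℕ) : Set ℤ :=
  {s | ∃ F : Finset ℕ, F.Nonempty ∧ (∀ i ∈ F, N ≤ i) ∧ s = ∑ i ∈ F, x i}

theorem FS_eq_tailSums (x : Stream' ℤ) : Hindman.FS x = tailSums x.get 0 := by
  ext s
  constructor
  · intro h
    induction h with
    | head' x => exact ⟨{0}, by simp, by simp, by simp [Stream'.head]⟩
    | tail' x s _ ih =>
      obtain ⟨F, hF, -, rfl⟩ := ih
      refine ⟨F.map (addRightEmbedding 1), by simpa using hF, by simp, ?_⟩
      rw [Finset.sum_map]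
      rfl
    | cons' x s _ ih =>
      obtain ⟨F, hF, -, rfl⟩ := ih
      refine ⟨insert 0 (F.map (addRightEmbedding 1)), by simp, by simp, ?_⟩
      rw [Finset.sum_insert (by simp), Finset.sum_map]
      rfl
  · rintro ⟨F, hF, -, rfl⟩
    exact Hindman.FS.finsetSum x F hF

/-- The only vanishing combination of `x` with coefficients of absolute value less than `p` is
the trivial one. -/
def Dissociated (x : ℕ → ℤ) (p : ℕ) : Prop :=
  ∀ (s : Finset ℕ) (t : ℕ → ℤ), (∀ i ∈ s, |t i| < p) → ∑ i ∈ s, t i * x i = 0 → ∀ i ∈ s, t i = 0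

/-- The integers whose last nonzero digit in base `p` is `c`. -/
def lastDigitClass (p : ℕ) (c : ZMod p) : Set ℤ :=
  {x | ∃ (v : ℕ) (u : ℤ), x = (p : ℤ) ^ v * u ∧ (u : ZMod p) = c}

theorem exists_mem_lastDigitClass {p : ℕ} (hp : p.Prime) {x : ℤ} (hx : x ≠ 0) :
    ∃ c : ZMod p, c ≠ 0 ∧ x ∈ lastDigitClass p c := by
  have := Fact.mk hp
  obtain ⟨u, hu, hd⟩ :=
    ((padicValRat.finite_int_prime_iff (p := p)).2 hx).exists_eq_pow_mul_and_not_dvd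
  exact ⟨u, by rwa [Ne, ZMod.intCast_zmod_eq_zero_iff_dvd], _, u, hu, rfl⟩

theorem le_of_pow_mul_eq {p : ℕ} (hp : p.Prime) {v w : ℕ} {u z : ℤ} (hu : ¬(p : ℤ) ∣ u)
    (h : (p : ℤ) ^ v * u = (p : ℤ) ^ w * z) : w ≤ v := by
  by_contra! hlt
  obtain ⟨d, rfl⟩ := Nat.exists_eq_add_of_lt hlt
  have h0 : (p : ℤ) ^ v ≠ 0 := pow_ne_zero _ (by exact_mod_cast hp.ne_zero)
  refine hu ⟨(p : ℤ) ^ d * z, mul_left_cancel₀ h0 ?_⟩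
  rw [h]
  ring

/-- The `x i` have distinct `p`-adic valuations: two terms of equal valuation would have a sum with
last digit `2c ≠ c`. In a vanishing combination, the nonzero term of least valuation then cannot
cancel, its coefficient being prime to `p`. -/
theorem dissociated_of_FS_subset {p : ℕ} (hp : p.Prime) (hp2 : 2 < p) {c : ZMod p} (hc : c ≠ 0)
    {x : ℕ → ℤ} (hx : tailSums x 0 ⊆ lastDigitClass p c) : Dissociated x p := by
  have := Fact.mk hp
  have hpZ : (p : ℤ) ≠ 0 := by exact_mod_cast hp.ne_zero
  have hmem : ∀ i, x i ∈ lastDigitClass p c := fun i => hx ⟨{i}, by simp, by simp, by simp⟩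
  choose v u hxu hu using hmem
  have hndvd : ∀ i, ¬(p : ℤ) ∣ u i := fun i h =>
    hc (by rw [← hu i, ZMod.intCast_zmod_eq_zero_iff_dvd]; exact h)
  have h2 : (2 : ZMod p) ≠ 0 := by
    intro h
    have : ((2 : ℕ) : ZMod p) = 0 := by exact_mod_cast h
    rw [ZMod.natCast_eq_zero_iff] at this
    exact absurd (Nat.le_of_dvd (by norm_num) this) (by omega)
  have hinj : Function.Injective v := by
    intro i j hij
    by_contra hne
    obtain ⟨w, z, hw, hz⟩ := hx ⟨{i, j}, by simp, by simp, (Finset.sum_pair hne).symm⟩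
    have hcast : ((u i + u j : ℤ) : ZMod p) = 2 * c := by
      push_cast
      rw [hu, hu, two_mul]
    have hsum : (p : ℤ) ^ v i * (u i + u j) = (p : ℤ) ^ w * z := by
      rw [← hw, hxu i, hxu j, hij]
      ring
    have h₁ : ¬(p : ℤ) ∣ u i + u j := by
      rw [← ZMod.intCast_zmod_eq_zero_iff_dvd, hcast]
      exact mul_ne_zero h2 hc
    have h₃ : ¬(p : ℤ) ∣ z := by
      rw [← ZMod.intCast_zmod_eq_zero_iff_dvd, hz]
      exact hc
    have hvw : v i = w :=
      le_antisymm (le_of_pow_mul_eq hp h₃ hsum.symm) (le_of_pow_mul_eq hp h₁ hsum)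
    rw [hvw] at hsum
    rw [mul_left_cancel₀ (pow_ne_zero _ hpZ) hsum, hz, two_mul] at hcast
    exact hc (left_eq_add.1 hcast)
  intro s t ht hsum
  by_contra! hne
  obtain ⟨i₀, hi₀, ht₀⟩ := hne
  obtain ⟨i, hi, hmin⟩ := Finset.exists_min_image (s.filter fun i => t i ≠ 0) v
    ⟨i₀, by simp [hi₀, ht₀]⟩
  rw [Finset.mem_filter] at hi
  have hdvd : (p : ℤ) ^ (v i + 1) ∣ t i * x i := by
    rw [← Finset.add_sum_erase s _ hi.1] at hsum
    rw [eq_neg_of_add_eq_zero_left hsum, dvd_neg]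
    refine Finset.dvd_sum fun j hj => ?_
    rw [Finset.mem_erase] at hj
    by_cases htj : t j = 0
    · simp [htj]
    · have hle := hmin j (by simp [hj.2, htj])
      have hlt : v i < v j := lt_of_le_of_ne hle fun h => hj.1 (hinj h).symm
      rw [hxu j]
      exact ((pow_dvd_pow _ hlt).mul_right _).mul_left _
  rw [hxu i, pow_succ, mul_left_comm, mul_dvd_mul_iff_left (pow_ne_zero _ hpZ)] at hdvd
  rcases (Nat.prime_iff_prime_int.1 hp).dvd_or_dvd hdvd with h | h
  · exact hi.2 (Int.eq_zero_of_abs_lt_dvd h (ht i hi.1))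
  · exact hndvd i h

theorem Dissociated.finset_eq {x : ℕ → ℤ} {p : ℕ} (hx : Dissociated x p) (hp : 1 < p)
    {F G : Finset ℕ} (h : ∑ i ∈ F, x i = ∑ i ∈ G, x i) : F = G := by
  classical
  have key := hx (F ∪ G) (fun i => (if i ∈ F then 1 else 0) - (if i ∈ G then 1 else 0))
    (fun i _ => by split_ifs <;> norm_num <;> omega)
    (by
      simp only [sub_mul, ite_mul, one_mul, zero_mul, Finset.sum_sub_distrib,
        Finset.sum_ite_mem, Finset.union_inter_cancel_left, Finset.union_inter_cancel_right]
      rw [h, sub_self])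
  ext i
  by_cases hF : i ∈ F
  · have := key i (by simp [hF])
    by_cases hG : i ∈ G <;> simp_all
  · by_cases hG : i ∈ G
    · have := key i (by simp [hG])
      simp_all
    · simp [hF, hG]

/-- The coefficients of the difference lie in `[-1, 2]`, whence `2 < p`, and the one at `n` is `1 +
1 - 1`. -/
theorem Dissociated.add_ne {x : ℕ → ℤ} {p : ℕ} (hx : Dissociated x p) (hp : 2 < p)
    {F G H : Finset ℕ} {n : ℕ} (hF : n ∈ F) (hG : n ∈ G) (hH : n ∈ H) :
    ∑ i ∈ F, x i + ∑ i ∈ G, x i ≠ ∑ i ∈ H, x i := by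
  classical
  intro h
  have key := hx (F ∪ G ∪ H)
    (fun i => (if i ∈ F then 1 else 0) + (if i ∈ G then 1 else 0) - (if i ∈ H then 1 else 0))
    (fun i _ => by split_ifs <;> norm_num <;> omega)
    (by
      simp only [sub_mul, add_mul, ite_mul, one_mul, zero_mul, Finset.sum_sub_distrib,
        Finset.sum_add_distrib, Finset.sum_ite_mem]
      rw [Finset.inter_eq_right.2 (by intro; simp; tauto : F ⊆ F ∪ G ∪ H),
        Finset.inter_eq_right.2 (by intro; simp; tauto : G ⊆ F ∪ G ∪ H),
        Finset.inter_eq_right.2 (by intro; simp; tauto : H ⊆ F ∪ G ∪ H), h, sub_self])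
    n (by simp [hF])
  simp [hF, hG, hH] at key

/-! ### Strongly summable ultrafilters -/

theorem IsStronglySummable.compl_zero_mem {U : Ultrafilter ℤ} (hU : IsStronglySummable U) :
    {0}ᶜ ∈ U := by
  rw [Ultrafilter.compl_mem_iff_notMem]
  intro h
  obtain ⟨x, hinj, hsub, -⟩ := hU _ h
  have h0 := hsub (Hindman.FS.singleton x 0)
  have h1 := hsub (Hindman.FS.singleton x 1)
  rw [Set.mem_singleton_iff] at h0 h1
  exact absurd (hinj (h0.trans h1.symm)) (by norm_num)

theorem IsStronglySummable.exists_lastDigitClass_mem {U : Ultrafilter ℤ}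
    (hU : IsStronglySummable U) {p : ℕ} (hp : p.Prime) :
    ∃ c : ZMod p, c ≠ 0 ∧ lastDigitClass p c ∈ U := by
  have := Fact.mk hp
  have hcover : (⋃ c ∈ {c : ZMod p | c ≠ 0}, lastDigitClass p c) ∈ U := by
    filter_upwards [hU.compl_zero_mem] with x hx
    obtain ⟨c, hc, hxc⟩ := exists_mem_lastDigitClass hp hx
    exact Set.mem_biUnion (show c ∈ {c : ZMod p | c ≠ 0} from hc) hxc
  obtain ⟨c, hc, h⟩ := (Ultrafilter.finite_biUnion_mem_iff (Set.toFinite _)).1 hcover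
  exact ⟨c, hc, h⟩

/-- Otherwise the sums using index `n` would contain some `y₀`, `y₁` and `y₀ + y₁`. -/
theorem IsStronglySummable.sum_avoiding_mem {U : Ultrafilter ℤ} (hU : IsStronglySummable U)
    {p : ℕ} (hp : 2 < p) {x : ℕ → ℤ} (hx : Dissociated x p) (hmem : tailSums x 0 ∈ U) (n : ℕ) :
    {s | ∃ F : Finset ℕ, n ∉ F ∧ s = ∑ i ∈ F, x i} ∈ U := by
  by_contra hnot
  have hB : {s | ∃ F : Finset ℕ, n ∈ F ∧ s = ∑ i ∈ F, x i} ∈ U := by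
    filter_upwards [hmem, Ultrafilter.compl_mem_iff_notMem.2 hnot] with s hs hs'
    obtain ⟨F, -, -, rfl⟩ := hs
    exact ⟨F, by_contra fun hF => hs' ⟨F, hF, rfl⟩, rfl⟩
  obtain ⟨y, -, hsub, -⟩ := hU _ hB
  obtain ⟨F, hF, hF'⟩ := hsub (Hindman.FS.singleton y 0)
  obtain ⟨G, hG, hG'⟩ := hsub (Hindman.FS.singleton y 1)
  obtain ⟨H, hH, hH'⟩ := hsub (Hindman.FS.add_two y 0 1 one_pos)
  exact hx.add_ne hp hF hG hH (by rw [← hF', ← hG', hH'])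

theorem IsStronglySummable.tailSums_mem {U : Ultrafilter ℤ} (hU : IsStronglySummable U)
    {p : ℕ} (hp : 2 < p) {x : ℕ → ℤ} (hx : Dissociated x p) (hmem : tailSums x 0 ∈ U) (N : ℕ) :
    tailSums x N ∈ U := by
  induction N with
  | zero => exact hmem
  | succ N ih =>
    filter_upwards [ih, hU.sum_avoiding_mem hp hx hmem N] with s hs hs'
    obtain ⟨F, hF, hN, rfl⟩ := hs
    obtain ⟨G, hG, hFG⟩ := hs'
    obtain rfl := hx.finset_eq (by omega) hFG
    refine ⟨F, hF, fun i hi => Nat.succ_le_of_lt (lt_of_le_of_ne (hN i hi) ?_), rfl⟩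
    rintro rfl
    exact hG hi

/-- Every member of a strongly summable ultrafilter contains the finite sums of a dissociated
sequence, all of whose tails have their set of finite sums in the ultrafilter. -/
theorem IsStronglySummable.exists_dissociated {U : Ultrafilter ℤ} (hU : IsStronglySummable U)
    {p : ℕ} (hp : p.Prime) (hp2 : 2 < p) {A : Set ℤ} (hA : A ∈ U) :
    ∃ x : ℕ → ℤ, Dissociated x p ∧ tailSums x 0 ⊆ A ∧ ∀ N, tailSums x N ∈ U := by
  obtain ⟨c, hc, hcU⟩ := hU.exists_lastDigitClass_mem hp
  obtain ⟨x, -, hsub, hmem⟩ := hU _ (Filter.inter_mem hA hcU)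
  rw [FS_eq_tailSums] at hsub hmem
  have hx := dissociated_of_FS_subset hp hp2 hc (hsub.trans Set.inter_subset_right)
  exact ⟨x.get, hx, hsub.trans Set.inter_subset_left, hU.tailSums_mem hp2 hx hmem⟩

theorem IsStronglySummable.isAddIdempotent {U : Ultrafilter ℤ} (hU : IsStronglySummable U) :
    IsAddIdempotent U := by
  refine (Ultrafilter.coe_le_coe.1 fun A hA => ?_).symm
  by_contra hAU
  obtain ⟨x, -, hsub, hmem⟩ := hU.exists_dissociated Nat.prime_three (by norm_num)
    (Ultrafilter.compl_mem_iff_notMem.2 hAU)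
  have hA' : ∀ᶠ s in (U : Filter ℤ), ∀ᶠ t in (U : Filter ℤ), s + t ∈ A := hA
  obtain ⟨s, hs, F, hF, -, rfl⟩ := (hA'.and (hmem 0)).exists
  -- Starting the tail beyond `max F` makes `s + t` again a finite sum of `x`.
  obtain ⟨t, ht, G, hG, hGF, rfl⟩ := (hs.and (hmem (F.sup id + 1))).exists
  have hdisj : Disjoint F G := Finset.disjoint_left.2 fun i hi hi' => by
    have h₁ : i ≤ F.sup id := Finset.le_sup (f := id) hi
    have h₂ := hGF i hi'
    omega
  exact hsub ⟨F ∪ G, hF.mono Finset.subset_union_left, by simp,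
    (Finset.sum_union hdisj).symm⟩ ht

/-! ### Coherent strings and their values -/

theorem coherent_replicate_zero (n : ℕ) : Coherent (List.replicate n 0) [] := by
  induction n with
  | zero => exact .refl _
  | succ n ih => exact Coherent.append (σ := [0]) (σ' := []) Coherent.nil_zero.symm ih

/-- A string with entries `0` and `a` is coherent with `(a)` or with `()`, according to whether
`a` occurs. -/
theorem coherent_map_ite (a : ℤ) (q : ℕ → Prop) [DecidablePred q] (l : List ℕ) :
    Coherent (l.map fun i => if q i then a else 0) (if ∃ i ∈ l, q i then [a] else []) := by
  induction l with
  | nil => simpa using Coherent.refl []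
  | cons i l ih =>
    by_cases hi : q i
    · have h := Coherent.append (Coherent.refl [a]) ih
      have : Coherent ([a] ++ if ∃ i ∈ l, q i then [a] else []) [a] := by
        split_ifs
        · exact (Coherent.dup a).symm
        · exact Coherent.refl _
      simpa [hi] using h.trans this
    · simpa [hi] using Coherent.append Coherent.nil_zero.symm ih

/-- The value `∑ lᵢ xₙ₊ᵢ` of a string of coefficients at the sequence `x` from the index `n` on. -/
def stringSum (x : ℕ → ℤ) : ℕ → List ℤ → ℤ
  | _, [] => 0
  | n, a :: l => a * x n + stringSum x (n + 1) l

theorem stringSum_append (x : ℕ → ℤ) (n : ℕ) (l l' : List ℤ) :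
    stringSum x n (l ++ l') = stringSum x n l + stringSum x (n + l.length) l' := by
  induction l generalizing n with
  | nil => simp [stringSum]
  | cons a l ih =>
    rw [List.cons_append, stringSum, stringSum, ih, List.length_cons,
      Nat.add_right_comm n 1 l.length, Nat.add_assoc n, add_assoc]

theorem stringSum_eq_sum_range (x : ℕ → ℤ) (n : ℕ) (l : List ℤ) {k : ℕ} (hk : l.length ≤ k) :
    stringSum x n l = ∑ i ∈ Finset.range k, l.getD i 0 * x (n + i) := by
  induction l generalizing n k with
  | nil => simp [stringSum]
  | cons a l ih =>
    obtain ⟨k, rfl⟩ : ∃ k', k = k' + 1 := ⟨k - 1, by simp at hk; omega⟩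
    rw [Finset.sum_range_succ', stringSum, ih (n + 1) (by simpa using hk), add_comm]
    simp [add_right_comm n 1, add_assoc]

theorem stringSum_map_ite (x : ℕ → ℤ) (a : ℤ) (F : Finset ℕ) (n d : ℕ) :
    stringSum x n ((List.range' n d).map fun i => if i ∈ F then a else 0) =
      ∑ i ∈ Finset.Ico n (n + d), if i ∈ F then a * x i else 0 := by
  induction d generalizing n with
  | zero => simp [stringSum]
  | succ d ih =>
    rw [List.range'_succ, List.map_cons, stringSum, ih,
      Finset.sum_eq_sum_Ico_succ_bot (show n < n + (d + 1) by omega)]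
    rw [show n + 1 + d = n + (d + 1) by omega]
    simp

theorem ofFn_getD (l : List ℤ) {k : ℕ} (hk : l.length ≤ k) :
    List.ofFn (fun i : Fin k => l.getD i 0) = l ++ List.replicate (k - l.length) 0 := by
  apply List.ext_getElem
  · simp [hk]
  · intro i h₁ h₂
    simp [List.getElem_append, List.getD_eq_getElem?_getD]
    split_ifs with h <;> simp [h]

/-- The values, from the index `N` on, of the strings coherent with `σ` with entries among those
of `σ` and `0`. -/
def coherentSums (x : ℕ → ℤ) (σ : List ℤ) (N : ℕ) : Set ℤ :=
  {t | ∃ l : List ℤ, Coherent l σ ∧ (∀ b ∈ l, b = 0 ∨ b ∈ σ) ∧ t = stringSum x N l}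

/-- The head `a` multiplies a sum over a nonempty `F` inside a block `[N, N + d)`, which is a string
of `0`s and `a`s coherent with `(a)`. The rest is taken from index `N + d` on, so the strings
concatenate; this is why `N` varies. -/
theorem coherentSums_mem_linComb {U : Ultrafilter ℤ} {x : ℕ → ℤ} (hx : ∀ N, tailSums x N ∈ U)
    (σ : List ℤ) (N : ℕ) : coherentSums x σ N ∈ linComb σ U := by
  induction σ generalizing N with
  | nil => exact ⟨[], Coherent.refl _, by simp, rfl⟩
  | cons a σ ih =>
    rw [mem_linComb_cons]
    filter_upwards [hx N] with s hs
    obtain ⟨F, ⟨i₀, hi₀⟩, hFN, rfl⟩ := hs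
    have hlt : ∀ i ∈ F, i < N + (F.sup id + 1) := fun i hi => by
      have : i ≤ F.sup id := Finset.le_sup (f := id) hi
      omega
    generalize F.sup id + 1 = d at hlt
    filter_upwards [ih (N + d)] with t ht
    obtain ⟨l, hl, hlσ, rfl⟩ := ht
    refine ⟨(List.range' N d).map (fun i => if i ∈ F then a else 0) ++ l, ?_, ?_, ?_⟩
    · have h := coherent_map_ite a (· ∈ F) (List.range' N d)
      rw [if_pos ⟨i₀, by simpa [List.mem_range'_1] using ⟨hFN _ hi₀, hlt _ hi₀⟩, hi₀⟩] at h
      exact Coherent.append h hl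
    · intro b hb
      rcases List.mem_append.1 hb with hb | hb
      · obtain ⟨i, -, rfl⟩ := List.mem_map.1 hb
        split_ifs <;> simp
      · rcases hlσ b hb with h | h <;> simp [h]
    · rw [stringSum_append, stringSum_map_ite, Finset.sum_ite_mem, List.length_map,
        List.length_range', Finset.inter_eq_right.2 fun i hi =>
          Finset.mem_Ico.2 ⟨hFN i hi, hlt i hi⟩, Finset.mul_sum]

theorem Witnesses.hasSolutionInClass {m : ℕ} {P : MvPolynomial (Fin m) ℤ}
    (hP : P.IsHomogeneous 1) {σ : List ℤ} {U : Ultrafilter ℤ} (hU : IsStronglySummable U)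
    (h : Witnesses (linComb σ U) P) : HasSolutionInClass P σ := by
  set c : Fin m → ℤ := fun j => P.coeff (Finsupp.single j 1)
  set R : ℤ := (σ.map fun a => |a|).sum
  have hRnonneg : 0 ≤ R := List.sum_nonneg (by simp)
  have hRle : ∀ b ∈ σ, |b| ≤ R := fun b hb =>
    List.single_le_sum (by simp) _ (List.mem_map_of_mem hb)
  -- `p` exceeds every coefficient of the combined sum, since string entries are bounded by `R`.
  obtain ⟨p, hple, hp⟩ := Nat.exists_infinite_primes ((∑ j, |c j| * R).toNat + 3)
  obtain ⟨x, hx, -, hmem⟩ := hU.exists_dissociated hp (by omega) Filter.univ_mem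
  obtain ⟨a, ha, hPa⟩ := h _ (coherentSums_mem_linComb hmem σ 0)
  choose l hl hlσ hla using ha
  -- Common length: padding with trailing zeros changes neither value nor class.
  set k : ℕ := Finset.univ.sup fun j => (l j).length
  have hlk : ∀ j, (l j).length ≤ k := fun j =>
    Finset.le_sup (f := fun j => (l j).length) (Finset.mem_univ j)
  have hbound : ∀ j i, |(l j).getD i 0| ≤ R := by
    intro j i
    by_cases hi : i < (l j).length
    · rw [List.getD_eq_getElem _ _ hi]
      rcases hlσ j _ (List.getElem_mem hi) with h | h
      · simpa [h] using hRnonneg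
      · exact hRle _ h
    · rw [List.getD_eq_default _ _ (by omega)]
      simpa using hRnonneg
  have hzero := hx (Finset.range k) (fun i => ∑ j, c j * (l j).getD i 0)
    (fun i _ => by
      have h₁ : |∑ j, c j * (l j).getD i 0| ≤ ∑ j, |c j| * R :=
        (Finset.abs_sum_le_sum_abs _ _).trans <| Finset.sum_le_sum fun j _ => by
          rw [abs_mul]
          exact mul_le_mul_of_nonneg_left (hbound j i) (abs_nonneg _)
      omega)
    (by
      rw [eval_eq_sum_of_isHomogeneous_one hP] at hPa
      refine Eq.trans ?_ hPa
      simp_rw [hla, stringSum_eq_sum_range x 0 _ (hlk _), Finset.sum_mul, Finset.mul_sum,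
        zero_add, mul_assoc]
      exact Finset.sum_comm)
  refine ⟨k, fun j i => (l j).getD i 0, fun j => ?_, ?_⟩
  · rw [ofFn_getD _ (hlk j)]
    have := Coherent.append (hl j) (coherent_replicate_zero (k - (l j).length))
    rwa [List.append_nil] at this
  · ext i
    simpa using hzero i (by simp)

end

end StringPR

theorem mainTheorem1
    (hESS : ∃ U : Ultrafilter ℤ, StringPR.IsStronglySummable U)
    (m : ℕ) (P : MvPolynomial (Fin m) ℤ) (hP : P.IsHomogeneous 1)
    (σ : List ℤ) (hσ : StringPR.IsReduced σ) :
    List.TFAE [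
      ∀ U : Ultrafilter ℤ, StringPR.IsAddIdempotent U →
        StringPR.Witnesses (StringPR.linComb σ U) P,
      ∃ U : Ultrafilter ℤ, StringPR.IsStronglySummable U ∧
        StringPR.Witnesses (StringPR.linComb σ U) P,
      StringPR.HasSolutionInClass P σ] := by
  tfae_have 1 → 2 := fun h =>
    let ⟨U, hU⟩ := hESS
    ⟨U, hU, h U hU.isAddIdempotent⟩
  tfae_have 2 → 3 := fun ⟨_, hU, h⟩ => h.hasSolutionInClass hP hU
  tfae_have 3 → 1 := fun h _ hU => h.witnesses hP hU
  tfae_finish
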